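/- For a complex $n\times n$ matrix $A$ let $\|A\|_\infty$ be its operator norm on $\mathbb C^n$ with the Euclidean norm. The Schur multiplier norm of $Y\in M_n(\mathbb C)$ is $$\|Y\|_S=\sup\{\|Y\circ A\|_\infty : A\in M_n(\mathbb C),\ \|A\|_\infty\le 1\},$$ where $Y\circ A$ is the entrywise product, and $\|X\|_{cbB}=\sup\{|\mathrm{Tr}_n(Y^*X)| : Y\in M_n(\mathbb C),\ \|Y\|_S\le 1\}$ is its dual norm. For $\lambda\in\mathbb R^n$ let $\Delta(\lambda)$ be the diagonal matrix with diagonal $\lambda$; a diagonal matrix $\Delta(\lambda)$ is called positive if all $\lambda_i\ge 0$. The order on self-adjoint matrices is the usual (positive semidefinite) one, and the support of a matrix is the orthogonal complement of its kernel. Let $X$ be a complex self-adjoint $n\times n$ matrix. 1. If $\Delta(\lambda)$ is a positive diagonal matrix with $-\Delta(\lambda)\le X\le\Delta(\lambda)$, then $\|X\|_{cbB}\le \mathrm{Tr}_n(\Delta(\lambda))$. 2. There exists a unique positive diagonal matrix $\Delta(\lambda)$ such that $\mathrm{Tr}_n(\Delta(\lambda))=\|X\|_{cbB}$ and $X=\sqrt{\Delta(\lambda)}\,B\,\sqrt{\Delta(\lambda)}$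 for some self-adjoint matrix $B$ with $\|B\|_\infty\le 1$. 3. For this $\Delta(\lambda)$ there is exactly one self-adjoint matrix $B$ with $\|B\|_\infty\le 1$ and $X=\sqrt{\Delta(\lambda)}\,B\,\sqrt{\Delta(\lambda)}$ whose support is contained in the support of $\Delta(\lambda)$. -/

import Mathlib

open scoped Matrix MatrixOrder Matrix.Norms.L2Operator

noncomputable section

namespace SchurDual

/-- The entrywise (Schur) multiplication `A ↦ Y ∘ A` on complex `m × n` matrices. -/
def schurMul {m n : ℕ} (Y : Matrix (Fin m) (Fin n) ℂ) :
    Matrix (Fin m) (Fin n) ℂ →ₗ[ℂ] Matrix (Fin m) (Fin n) ℂ where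
  toFun A := Y ⊙ A
  map_add' A B := Matrix.hadamard_add Y A B
  map_smul' c A := Matrix.hadamard_smul Y A c

/-- The Schur multiplier norm: the norm of `A ↦ Y ∘ A` as an operator on the space of matrices
equipped with the operator norm (the norm `‖A‖` of a matrix is everywhere the one of the operator
between Euclidean spaces). -/
def schurNorm {m n : ℕ} (Y : Matrix (Fin m) (Fin n) ℂ) : ℝ :=
  ‖LinearMap.toContinuousLinearMap (schurMul Y)‖

/-- The dual norm of the Schur multiplier norm for the pairing `⟨X, Y⟩ = Tr (Y* X)`. -/
def cbBNorm {m n : ℕ} (X : Matrix (Fin m) (Fin n) ℂ) : ℝ :=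
  sSup {r : ℝ | ∃ Y : Matrix (Fin m) (Fin n) ℂ, schurNorm Y ≤ 1 ∧ r = ‖(Yᴴ * X).trace‖}

/-- The complex diagonal matrix with real diagonal `lam`. -/
def Delta {n : ℕ} (lam : Fin n → ℝ) : Matrix (Fin n) (Fin n) ℂ :=
  Matrix.diagonal fun i => (lam i : ℂ)

/-- The positive square root of `Delta lam`, for `lam` with nonnegative entries. -/
def sqrtDelta {n : ℕ} (lam : Fin n → ℝ) : Matrix (Fin n) (Fin n) ℂ :=
  Delta fun i => Real.sqrt (lam i)

/-- The support of a matrix, as a subspace: the orthogonal complement of its kernel. -/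
def support {m n : ℕ} (A : Matrix (Fin m) (Fin n) ℂ) : Submodule ℂ (EuclideanSpace ℂ (Fin n)) :=
  (LinearMap.ker (Matrix.toEuclideanLin A))ᗮ

/-- `X = √Δ(lam) B √Δ(lam)` with `B` a self-adjoint contraction. -/
def IsFactor {n : ℕ} (X : Matrix (Fin n) (Fin n) ℂ) (lam : Fin n → ℝ)
    (B : Matrix (Fin n) (Fin n) ℂ) : Prop :=
  B.IsHermitian ∧ ‖B‖ ≤ 1 ∧ X = sqrtDelta lam * B * sqrtDelta lam

end SchurDual

end

/-! The theorem is a semidefinite duality. A bound `-Δ ≤ X ≤ Δ` is the same as a factorization `X =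
√Δ B √Δ` with `B` a self-adjoint contraction, and then `Tr (Y* X)` is, up to conjugation, a form of
`Y ∘ B̄` at the vector `√λ`, so `‖X‖_cbB ≤ Σ λ_i`.

For equality, maximise `Re Tr (X (P - Q))` over `P, Q ≥ 0` with `P + Q` of unit diagonal. Each `P -
Q` has Schur norm at most 1 (`schurNorm_sub_le_one`). The first variation at a maximiser
(`IsOptimal.form_le`) shows that `λ_i = Re ((P - Q) X)_ii` satisfies the bound; its trace is the
maximum, so the two estimates meet.

Uniqueness is complementary slackness (`IsOptimal.eq_of_sum_eq`): one maximiser determines every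
optimal `λ`. On the support of `Δ` the factorization can be solved for `B`. -/

namespace SchurDual

open scoped ComplexOrder

variable {n : ℕ}

/-! ### Operator norms and sesquilinear forms -/

theorem norm_toLp_sq (u : Fin n → ℂ) : ‖WithLp.toLp 2 u‖ ^ 2 = ∑ i, ‖u i‖ ^ 2 := by
  rw [EuclideanSpace.norm_sq_eq]

/-- The arithmetic mean replaces the product of norms so that such bounds can be added with weights.
-/
theorem norm_form_le (M : Matrix (Fin n) (Fin n) ℂ) (u v : Fin n → ℂ) :
    ‖star v ⬝ᵥ M *ᵥ u‖ ≤ ‖M‖ * ((∑ i, ‖u i‖ ^ 2 + ∑ i, ‖v i‖ ^ 2) / 2) := by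
  have h1 : star v ⬝ᵥ M *ᵥ u = inner ℂ (WithLp.toLp 2 v) (WithLp.toLp 2 (M *ᵥ u)) := by
    rw [EuclideanSpace.inner_eq_star_dotProduct, dotProduct_comm]
  have h2 := Matrix.l2_opNorm_mulVec M (WithLp.toLp 2 u)
  have h3 := norm_inner_le_norm (𝕜 := ℂ) (WithLp.toLp 2 v) (WithLp.toLp 2 (M *ᵥ u))
  have h4 := mul_le_mul_of_nonneg_left h2 (norm_nonneg (WithLp.toLp 2 v))
  rw [h1, ← norm_toLp_sq, ← norm_toLp_sq]
  have h5 := mul_nonneg (norm_nonneg M)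
    (sq_nonneg (‖WithLp.toLp 2 u‖ - ‖WithLp.toLp 2 v‖))
  refine (h3.trans h4).trans ?_
  linarith

theorem opNorm_le_of_form {M : Matrix (Fin n) (Fin n) ℂ} {c : ℝ} (hc : 0 ≤ c)
    (h : ∀ u v : Fin n → ℂ,
      (star v ⬝ᵥ M *ᵥ u).re ≤ c * ((∑ i, ‖u i‖ ^ 2 + ∑ i, ‖v i‖ ^ 2) / 2)) : ‖M‖ ≤ c := by
  rw [Matrix.cstar_norm_def]
  refine ContinuousLinearMap.opNorm_le_of_unit_norm hc fun x hx => ?_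
  set w := Matrix.toEuclideanCLM (n := Fin n) (𝕜 := ℂ) M x with hw
  by_cases hw0 : w = 0
  · rw [hw0, norm_zero]; exact hc
  have hwn : ‖w‖ ≠ 0 := norm_ne_zero_iff.2 hw0
  set y := ((‖w‖⁻¹ : ℝ) : ℂ) • w with hy
  have hy1 : ‖y‖ = 1 := by
    rw [hy, norm_smul, Complex.norm_real, norm_inv, norm_norm, inv_mul_cancel₀ hwn]
  have h1 : star y.ofLp ⬝ᵥ M *ᵥ x.ofLp = (‖w‖ : ℂ) := by
    have : star y.ofLp ⬝ᵥ M *ᵥ x.ofLp = inner ℂ y w := by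
      rw [EuclideanSpace.inner_eq_star_dotProduct, dotProduct_comm, hw,
        Matrix.ofLp_toEuclideanCLM]
    rw [this, hy, inner_smul_left, inner_self_eq_norm_sq_to_K, Complex.conj_ofReal]
    have hwc : (‖w‖ : ℂ) ≠ 0 := by exact_mod_cast hwn
    rw [Complex.ofReal_inv, sq]
    exact inv_mul_cancel_left₀ hwc _
  have h2 := h x.ofLp y.ofLp
  rw [h1, ← EuclideanSpace.norm_sq_eq, ← EuclideanSpace.norm_sq_eq, hx, hy1,
    Complex.ofReal_re] at h2
  linarith

/-! ### Schur multipliers from positive semidefinite matrices -/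

theorem form_diagonal_conj (A : Matrix (Fin n) (Fin n) ℂ) (d u v : Fin n → ℂ) :
    star v ⬝ᵥ (Matrix.diagonal (star d) * A * Matrix.diagonal d) *ᵥ u =
      star (d * v) ⬝ᵥ A *ᵥ (d * u) := by
  simp only [dotProduct, Matrix.mulVec, Matrix.mul_diagonal, Matrix.diagonal_mul, Pi.star_apply,
    Pi.mul_apply, star_mul']
  refine Finset.sum_congr rfl fun i _ => ?_
  rw [Finset.mul_sum, Finset.mul_sum]
  exact Finset.sum_congr rfl fun j _ => by ring

theorem hadamard_gram (W A : Matrix (Fin n) (Fin n) ℂ) :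
    (Wᴴ * W) ⊙ A = ∑ k, Matrix.diagonal (star (W k)) * A * Matrix.diagonal (W k) := by
  ext i j
  rw [Matrix.hadamard_apply, Matrix.mul_apply, Matrix.sum_apply, Finset.sum_mul]
  simp only [Matrix.mul_diagonal, Matrix.diagonal_mul, Matrix.conjTranspose_apply, Pi.star_apply]
  exact Finset.sum_congr rfl fun j _ => by ring

theorem re_gram_diag (W : Matrix (Fin n) (Fin n) ℂ) (i : Fin n) :
    ((Wᴴ * W) i i).re = ∑ k, ‖W k i‖ ^ 2 := by
  simp only [Matrix.mul_apply, Matrix.conjTranspose_apply, Complex.re_sum]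
  refine Finset.sum_congr rfl fun k _ => ?_
  rw [← Complex.normSq_eq_norm_sq, Complex.normSq_apply]
  simp

/-- For `P = W* W`, the product `P ∘ A` is a sum of diagonal conjugates of `A`, one for each row of
`W`; the squared entries in column `i` of `W` add up to `P i i`. -/
theorem norm_form_hadamard_le {P : Matrix (Fin n) (Fin n) ℂ} (hP : P.PosSemidef)
    (A : Matrix (Fin n) (Fin n) ℂ) (u v : Fin n → ℂ) :
    ‖star v ⬝ᵥ (P ⊙ A) *ᵥ u‖ ≤
      ‖A‖ * ((∑ i, (P i i).re * ‖u i‖ ^ 2 + ∑ i, (P i i).re * ‖v i‖ ^ 2) / 2) := by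
  obtain ⟨W, rfl⟩ := CStarAlgebra.nonneg_iff_eq_star_mul_self.mp hP.nonneg
  rw [Matrix.star_eq_conjTranspose]
  have hdiag (u : Fin n → ℂ) : ∑ i, ((Wᴴ * W) i i).re * ‖u i‖ ^ 2 =
      ∑ k, ∑ i, ‖(W k * u) i‖ ^ 2 := by
    rw [Finset.sum_comm]
    refine Finset.sum_congr rfl fun i _ => ?_
    simp only [re_gram_diag, Finset.sum_mul, Pi.mul_apply, norm_mul, mul_pow]
  rw [hdiag, hdiag, hadamard_gram, Matrix.sum_mulVec, dotProduct_sum, ← Finset.sum_add_distrib,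
    Finset.sum_div, Finset.mul_sum]
  refine norm_sum_le_of_le _ fun k _ => ?_
  rw [form_diagonal_conj]
  exact norm_form_le _ _ _

theorem schurNorm_sub_le_one {P Q : Matrix (Fin n) (Fin n) ℂ} (hP : P.PosSemidef)
    (hQ : Q.PosSemidef) (hd : ∀ i, (P i i).re + (Q i i).re = 1) : schurNorm (P - Q) ≤ 1 := by
  refine ContinuousLinearMap.opNorm_le_bound _ zero_le_one fun A => ?_
  rw [one_mul]
  change ‖(P - Q) ⊙ A‖ ≤ ‖A‖
  refine opNorm_le_of_form (norm_nonneg _) fun u v => ?_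
  have hsub : (P - Q) ⊙ A = P ⊙ A - Q ⊙ A := by
    ext i j; simp [sub_mul]
  have hsum (u : Fin n → ℂ) : ∑ i, ‖u i‖ ^ 2 =
      ∑ i, (P i i).re * ‖u i‖ ^ 2 + ∑ i, (Q i i).re * ‖u i‖ ^ 2 := by
    rw [← Finset.sum_add_distrib]
    exact Finset.sum_congr rfl fun i _ => by rw [← add_mul, hd, one_mul]
  rw [hsub, Matrix.sub_mulVec, dotProduct_sub, hsum u, hsum v]
  have h1 := norm_form_hadamard_le hP A u v
  have h2 := norm_form_hadamard_le hQ A u v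
  have h3 := (Complex.re_le_norm _).trans
    (norm_sub_le (star v ⬝ᵥ (P ⊙ A) *ᵥ u) (star v ⬝ᵥ (Q ⊙ A) *ᵥ u))
  linarith

/-! ### Diagonal order bounds and factorizations -/

theorem form_Delta (lam : Fin n → ℝ) (v : Fin n → ℂ) :
    star v ⬝ᵥ Delta lam *ᵥ v = ((∑ i, lam i * ‖v i‖ ^ 2 : ℝ) : ℂ) := by
  simp only [Delta, dotProduct, Matrix.mulVec_diagonal, Pi.star_apply, Complex.ofReal_sum,
    Complex.ofReal_mul, Complex.ofReal_pow, ← Complex.conj_mul']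
  exact Finset.sum_congr rfl fun i _ => by rw [RCLike.star_def]; ring

theorem isHermitian_Delta (lam : Fin n → ℝ) : (Delta lam).IsHermitian := by
  rw [Delta, Matrix.isHermitian_diagonal_iff]
  intro i
  simp [isSelfAdjoint_iff]

theorem trace_Delta (lam : Fin n → ℝ) : (Delta lam).trace = ((∑ i, lam i : ℝ) : ℂ) := by
  simp [Delta, Matrix.trace_diagonal]

theorem form_swap {M : Matrix (Fin n) (Fin n) ℂ} (hM : M.IsHermitian) (u v : Fin n → ℂ) :
    star u ⬝ᵥ M *ᵥ v = star (star v ⬝ᵥ M *ᵥ u) := by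
  rw [← Matrix.star_dotProduct_star, star_star, Matrix.star_mulVec, hM.eq,
    Matrix.dotProduct_mulVec]

theorem le_Delta_iff {X : Matrix (Fin n) (Fin n) ℂ} (hX : X.IsHermitian) (lam : Fin n → ℝ) :
    X ≤ Delta lam ↔ ∀ v : Fin n → ℂ, (star v ⬝ᵥ X *ᵥ v).re ≤ ∑ i, lam i * ‖v i‖ ^ 2 := by
  rw [Matrix.le_iff, Matrix.posSemidef_iff_dotProduct_mulVec]
  have him (v : Fin n → ℂ) : (star v ⬝ᵥ X *ᵥ v).im = 0 :=
    Complex.conj_eq_iff_im.1 (form_swap hX v v).symm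
  simp only [(isHermitian_Delta lam).sub hX, true_and, Matrix.sub_mulVec, dotProduct_sub,
    form_Delta, Complex.le_def, him, Complex.ofReal_re, Complex.ofReal_im, and_true, sub_nonneg]

theorem neg_Delta_le_iff {X : Matrix (Fin n) (Fin n) ℂ} (hX : X.IsHermitian) (lam : Fin n → ℝ) :
    -Delta lam ≤ X ↔ ∀ v : Fin n → ℂ, -(star v ⬝ᵥ X *ᵥ v).re ≤ ∑ i, lam i * ‖v i‖ ^ 2 := by
  rw [neg_le, le_Delta_iff hX.neg]
  simp [Matrix.neg_mulVec]

/-- Polarization with `u + v` and `u - v`, followed by the parallelogram law. -/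
theorem opNorm_le_one_of_abs_form_le {B : Matrix (Fin n) (Fin n) ℂ} (hB : B.IsHermitian)
    (h : ∀ v : Fin n → ℂ, |(star v ⬝ᵥ B *ᵥ v).re| ≤ ∑ i, ‖v i‖ ^ 2) : ‖B‖ ≤ 1 := by
  refine opNorm_le_of_form zero_le_one fun u v => ?_
  have h1 := (le_abs_self _).trans (h (u + v))
  have h2 := (neg_le_abs _).trans (h (u - v))
  have h3 : (star u ⬝ᵥ B *ᵥ v).re = (star v ⬝ᵥ B *ᵥ u).re := by
    rw [form_swap hB]; rfl
  simp only [star_add, star_sub, Matrix.mulVec_add, Matrix.mulVec_sub, dotProduct_add,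
    dotProduct_sub, add_dotProduct, sub_dotProduct, Complex.add_re, Complex.sub_re, h3] at h1 h2
  have h4 : ∑ i, ‖(u + v) i‖ ^ 2 + ∑ i, ‖(u - v) i‖ ^ 2 =
      2 * (∑ i, ‖u i‖ ^ 2 + ∑ i, ‖v i‖ ^ 2) := by
    rw [← Finset.sum_add_distrib, ← Finset.sum_add_distrib, Finset.mul_sum]
    refine Finset.sum_congr rfl fun i _ => ?_
    have := parallelogram_law_with_norm ℝ (u i) (v i)
    simp only [Pi.add_apply, Pi.sub_apply]
    linarith
  linarith

theorem isFactor_bounds {X B : Matrix (Fin n) (Fin n) ℂ} {lam : Fin n → ℝ}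
    (hlam : ∀ i, 0 ≤ lam i) (h : IsFactor X lam B) : -Delta lam ≤ X ∧ X ≤ Delta lam := by
  obtain ⟨hB, hB1, rfl⟩ := h
  set d : Fin n → ℂ := fun i => (Real.sqrt (lam i) : ℂ) with hd
  have hs : sqrtDelta lam = Matrix.diagonal d := rfl
  have hds : star d = d := by ext i; simp [hd]
  have hh : (sqrtDelta lam * B * sqrtDelta lam).IsHermitian := by
    have := Matrix.isHermitian_mul_mul_conjTranspose (sqrtDelta lam) hB
    rwa [(show (sqrtDelta lam)ᴴ = sqrtDelta lam from isHermitian_Delta _)] at this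
  have key (v : Fin n → ℂ) : |(star v ⬝ᵥ (sqrtDelta lam * B * sqrtDelta lam) *ᵥ v).re| ≤
      ∑ i, lam i * ‖v i‖ ^ 2 := by
    have h1 := form_diagonal_conj B d v v
    rw [hds, ← hs] at h1
    rw [h1]
    refine (Complex.abs_re_le_norm _).trans ((norm_form_le _ _ _).trans ?_)
    have h2 : ∑ i, ‖(d * v) i‖ ^ 2 = ∑ i, lam i * ‖v i‖ ^ 2 := by
      refine Finset.sum_congr rfl fun i _ => ?_
      simp [hd, mul_pow, Real.sq_sqrt (hlam i)]
    rw [h2]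
    have h3 : 0 ≤ ∑ i, lam i * ‖v i‖ ^ 2 :=
      Finset.sum_nonneg fun i _ => mul_nonneg (hlam i) (sq_nonneg _)
    nlinarith
  exact ⟨(neg_Delta_le_iff hh lam).2 fun v => (neg_le_abs _).trans (key v),
    (le_Delta_iff hh lam).2 fun v => (le_abs_self _).trans (key v)⟩

/-- The two bounds force the form of `Δ - X ≥ 0` to vanish at `e_i`, so `e_i` lies in its kernel. -/
theorem apply_eq_zero_of_bounds {X : Matrix (Fin n) (Fin n) ℂ} {lam : Fin n → ℝ}
    (h1 : -Delta lam ≤ X) (h2 : X ≤ Delta lam) {i : Fin n} (hi : lam i = 0) (j : Fin n) :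
    X j i = 0 := by
  have hd : (Delta lam *ᵥ Pi.single i 1) = 0 := by
    ext k
    by_cases h : k = i <;> simp [Delta, Matrix.mulVec_diagonal, h, hi]
  have e1 := (Matrix.PosSemidef.dotProduct_mulVec_zero_iff (Matrix.le_iff.1 h2)
    (Pi.single i 1)).1
  have p1 := (Matrix.le_iff.1 h2).dotProduct_mulVec_nonneg (Pi.single i 1)
  have p2 := (Matrix.le_iff.1 h1).dotProduct_mulVec_nonneg (Pi.single i 1)
  rw [Matrix.sub_mulVec, hd, zero_sub] at e1 p1
  rw [sub_neg_eq_add, Matrix.add_mulVec, hd, add_zero] at p2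
  rw [dotProduct_neg] at e1 p1
  have := e1 (by rw [neg_eq_zero]; exact le_antisymm (neg_nonneg.1 p1) p2)
  have := congrFun this j
  simpa using this

/-- The matrix `Δ(lam)^{-1/2} X Δ(lam)^{-1/2}`, with the inverse taken on the support. -/
noncomputable def compression (X : Matrix (Fin n) (Fin n) ℂ) (lam : Fin n → ℝ) :
    Matrix (Fin n) (Fin n) ℂ :=
  Delta (fun i => (Real.sqrt (lam i))⁻¹) * X * Delta (fun i => (Real.sqrt (lam i))⁻¹)

theorem compression_apply (X : Matrix (Fin n) (Fin n) ℂ) (lam : Fin n → ℝ) (i j : Fin n) :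
    compression X lam i j =
      ((Real.sqrt (lam i))⁻¹ : ℝ) * X i j * ((Real.sqrt (lam j))⁻¹ : ℝ) := by
  simp [compression, Delta, Matrix.mul_diagonal, Matrix.diagonal_mul]

theorem sqrtDelta_mul_mul_apply (lam : Fin n → ℝ) (B : Matrix (Fin n) (Fin n) ℂ) (i j : Fin n) :
    (sqrtDelta lam * B * sqrtDelta lam) i j =
      (Real.sqrt (lam i) : ℂ) * B i j * (Real.sqrt (lam j) : ℂ) := by
  simp [sqrtDelta, Delta, Matrix.mul_diagonal, Matrix.diagonal_mul]

theorem isFactor_compression {X : Matrix (Fin n) (Fin n) ℂ} (hX : X.IsHermitian)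
    {lam : Fin n → ℝ} (hlam : ∀ i, 0 ≤ lam i) (h1 : -Delta lam ≤ X) (h2 : X ≤ Delta lam) :
    IsFactor X lam (compression X lam) := by
  set d : Fin n → ℂ := fun i => (((Real.sqrt (lam i))⁻¹ : ℝ) : ℂ) with hd
  have hc : compression X lam = Matrix.diagonal (star d) * X * Matrix.diagonal d := by
    have hds : star d = d := by ext i; simp [hd]
    rw [hds]; rfl
  have hh : (compression X lam).IsHermitian := by
    have := Matrix.isHermitian_mul_mul_conjTranspose (Delta fun i => (Real.sqrt (lam i))⁻¹) hX
    rwa [(isHermitian_Delta _).eq] at this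
  refine ⟨hh, opNorm_le_one_of_abs_form_le hh fun v => ?_, ?_⟩
  · rw [hc, form_diagonal_conj]
    refine (abs_le'.2 ⟨(le_Delta_iff hX lam).1 h2 _, (neg_Delta_le_iff hX lam).1 h1 _⟩).trans ?_
    refine Finset.sum_le_sum fun i _ => ?_
    rw [Pi.mul_apply, norm_mul, mul_pow, ← mul_assoc]
    refine mul_le_of_le_one_left (sq_nonneg _) ?_
    rw [hd, Complex.norm_real, Real.norm_eq_abs, sq_abs, inv_pow, Real.sq_sqrt (hlam i)]
    -- An inequality, since the product is 0 where `lam i = 0`.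
    exact mul_inv_le_one
  · ext i j
    rw [sqrtDelta_mul_mul_apply, compression_apply]
    rcases (hlam j).eq_or_lt with hj | hj
    · rw [apply_eq_zero_of_bounds h1 h2 hj.symm]; simp
    rcases (hlam i).eq_or_lt with hi | hi
    · rw [← hX.apply, apply_eq_zero_of_bounds h1 h2 hi.symm]; simp
    have hi' := (Real.sqrt_pos.2 hi).ne'
    have hj' := (Real.sqrt_pos.2 hj).ne'
    push_cast
    have hi'' : (Real.sqrt (lam i) : ℂ) ≠ 0 := by exact_mod_cast hi'
    have hj'' : (Real.sqrt (lam j) : ℂ) ≠ 0 := by exact_mod_cast hj'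
    field_simp

/-! ### The upper bound for the dual norm -/

theorem norm_trace_le_of_isFactor {X B Y : Matrix (Fin n) (Fin n) ℂ} {lam : Fin n → ℝ}
    (hlam : ∀ i, 0 ≤ lam i) (h : IsFactor X lam B) (hY : schurNorm Y ≤ 1) :
    ‖(Yᴴ * X).trace‖ ≤ ∑ i, lam i := by
  obtain ⟨hB, hB1, rfl⟩ := h
  set d : Fin n → ℂ := fun i => (Real.sqrt (lam i) : ℂ) with hd
  have hB' : ‖B.map star‖ ≤ 1 := by
    -- Transposing exchanges the two arguments of the form, so the bound for `B` carries over.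
    have hT : B.map star = Bᵀ := by
      ext i j; rw [Matrix.map_apply, hB.apply, Matrix.transpose_apply]
    refine opNorm_le_of_form zero_le_one fun u v => ?_
    have e : star v ⬝ᵥ B.map star *ᵥ u = star (star u) ⬝ᵥ B *ᵥ star v := by
      rw [hT, Matrix.mulVec_transpose, dotProduct_comm, ← Matrix.dotProduct_mulVec, star_star]
    have h1 := norm_form_le B (star v) (star u)
    rw [← e] at h1
    simp only [Pi.star_apply, norm_star] at h1
    refine (Complex.re_le_norm _).trans (h1.trans ?_)
    rw [add_comm (∑ i, ‖u i‖ ^ 2)]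
    gcongr
  have htr : (Yᴴ * (sqrtDelta lam * B * sqrtDelta lam)).trace =
      star (star d ⬝ᵥ (Y ⊙ B.map star) *ᵥ d) := by
    rw [Matrix.trace, dotProduct, star_sum]
    simp only [Matrix.diag_apply, Matrix.mul_apply (M := Yᴴ), sqrtDelta_mul_mul_apply]
    rw [Finset.sum_comm]
    refine Finset.sum_congr rfl fun i _ => ?_
    rw [Matrix.mulVec, dotProduct, Finset.mul_sum, star_sum]
    refine Finset.sum_congr rfl fun j _ => ?_
    simp only [Matrix.conjTranspose_apply, Matrix.hadamard_apply, Matrix.map_apply, star_mul',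
      Pi.star_apply, hd, RCLike.star_def, Complex.conj_ofReal, Complex.conj_conj]
    ring
  have hYB : ‖Y ⊙ B.map star‖ ≤ 1 :=
    ((LinearMap.toContinuousLinearMap (schurMul Y)).le_opNorm (B.map star)).trans
      (mul_le_one₀ hY (norm_nonneg _) hB')
  have hsum : ∑ i, ‖d i‖ ^ 2 = ∑ i, lam i :=
    Finset.sum_congr rfl fun i _ => by simp [hd, Real.sq_sqrt (hlam i)]
  rw [htr, norm_star]
  refine (norm_form_le _ _ _).trans ?_
  rw [hsum]
  have := Finset.sum_nonneg fun i (_ : i ∈ Finset.univ) => hlam i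
  nlinarith

theorem cbBNorm_le {X : Matrix (Fin n) (Fin n) ℂ} (hX : X.IsHermitian)
    {lam : Fin n → ℝ} (hlam : ∀ i, 0 ≤ lam i) (h1 : -Delta lam ≤ X) (h2 : X ≤ Delta lam) :
    cbBNorm X ≤ ∑ i, lam i := by
  refine Real.sSup_le ?_ (Finset.sum_nonneg fun i _ => hlam i)
  rintro r ⟨Y, hY, rfl⟩
  exact norm_trace_le_of_isFactor hlam (isFactor_compression hX hlam h1 h2) hY

/-- The order bounds make the set under the supremum bounded above. -/
theorem le_cbBNorm {X Y : Matrix (Fin n) (Fin n) ℂ} (hX : X.IsHermitian)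
    {lam : Fin n → ℝ} (hlam : ∀ i, 0 ≤ lam i) (h1 : -Delta lam ≤ X) (h2 : X ≤ Delta lam)
    (hY : schurNorm Y ≤ 1) : ‖(Yᴴ * X).trace‖ ≤ cbBNorm X := by
  refine le_csSup ⟨∑ i, lam i, ?_⟩ ⟨Y, hY, rfl⟩
  rintro r ⟨Y, hY, rfl⟩
  exact norm_trace_le_of_isFactor hlam (isFactor_compression hX hlam h1 h2) hY

/-! ### Supports and uniqueness of the contraction -/

/-- The kernel of `Δ` is spanned by the `e_i` with `lam i = 0`. -/
theorem support_le_support_Delta_iff {B : Matrix (Fin n) (Fin n) ℂ} {lam : Fin n → ℝ} :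
    support B ≤ support (Delta lam) ↔ ∀ i, lam i = 0 → ∀ j, B j i = 0 := by
  rw [support, support, Submodule.orthogonal_le_orthogonal_iff]
  constructor
  · intro h i hi j
    have hmem : EuclideanSpace.single i (1 : ℂ) ∈
        LinearMap.ker (Matrix.toEuclideanLin (Delta lam)) := by
      rw [LinearMap.mem_ker]
      ext k
      by_cases hk : k = i <;>
        simp [Delta, Matrix.mulVec_diagonal, hk, hi]
    have := congrArg (fun x : EuclideanSpace ℂ (Fin n) => x j) (LinearMap.mem_ker.1 (h hmem))
    simpa [Matrix.ofLp_toLpLin, Matrix.toLin'_apply] using this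
  · intro h x hx
    rw [LinearMap.mem_ker] at hx ⊢
    ext j
    rw [Matrix.ofLp_toLpLin, Matrix.toLin'_apply, Matrix.mulVec, dotProduct]
    refine Finset.sum_eq_zero fun i _ => ?_
    by_cases hi : lam i = 0
    · rw [h i hi, zero_mul]
    · have := congrArg (fun x : EuclideanSpace ℂ (Fin n) => x i) hx
      simp only [Matrix.ofLp_toLpLin, Matrix.toLin'_apply, Delta, Matrix.mulVec_diagonal] at this
      have hi' : (lam i : ℂ) ≠ 0 := by exact_mod_cast hi
      have hxi : x i = 0 := by simpa [hi] using this
      rw [hxi, mul_zero]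

theorem existsUnique_isFactor_support_le {X : Matrix (Fin n) (Fin n) ℂ} (hX : X.IsHermitian)
    {lam : Fin n → ℝ} (hlam : ∀ i, 0 ≤ lam i) (h1 : -Delta lam ≤ X) (h2 : X ≤ Delta lam) :
    ∃! B : Matrix (Fin n) (Fin n) ℂ, IsFactor X lam B ∧ support B ≤ support (Delta lam) := by
  refine ⟨compression X lam, ⟨isFactor_compression hX hlam h1 h2, ?_⟩, ?_⟩
  · rw [support_le_support_Delta_iff]
    intro i hi j
    rw [compression_apply, hi]; simp
  · rintro B ⟨⟨hB, -, hXB⟩, hs⟩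
    rw [support_le_support_Delta_iff] at hs
    ext i j
    rw [compression_apply]
    rcases (hlam j).eq_or_lt with hj | hj
    · rw [hs j hj.symm, ← hj]; simp
    rcases (hlam i).eq_or_lt with hi | hi
    · rw [← hB.apply, hs i hi.symm, ← hi]; simp
    have hi' : (Real.sqrt (lam i) : ℂ) ≠ 0 := by exact_mod_cast (Real.sqrt_pos.2 hi).ne'
    have hj' : (Real.sqrt (lam j) : ℂ) ≠ 0 := by exact_mod_cast (Real.sqrt_pos.2 hj).ne'
    rw [hXB, sqrtDelta_mul_mul_apply]
    push_cast
    field_simp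

/-! ### The maximisation problem -/

/-- The pair `(P, Q)` maximises `Re Tr (X (P - Q))` among the pairs of positive semidefinite
matrices for which `P + Q` has unit diagonal. -/
structure IsOptimal (X P Q : Matrix (Fin n) (Fin n) ℂ) : Prop where
  left : P.PosSemidef
  right : Q.PosSemidef
  diag : ∀ i, (P i i).re + (Q i i).re = 1
  le : ∀ P' Q' : Matrix (Fin n) (Fin n) ℂ, P'.PosSemidef → Q'.PosSemidef →
    (∀ i, (P' i i).re + (Q' i i).re = 1) → (X * (P' - Q')).trace.re ≤ (X * (P - Q)).trace.re

theorem IsOptimal.neg_swap {X P Q : Matrix (Fin n) (Fin n) ℂ} (h : IsOptimal X P Q) :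
    IsOptimal (-X) Q P where
  left := h.right
  right := h.left
  diag i := by rw [add_comm, h.diag]
  le P' Q' hP' hQ' hd := by
    have := h.le Q' P' hQ' hP' fun i => by rw [add_comm, hd]
    rwa [Matrix.neg_mul, ← Matrix.mul_neg, neg_sub, Matrix.neg_mul, ← Matrix.mul_neg, neg_sub]

theorem IsOptimal.le_of_diag_le {X P Q : Matrix (Fin n) (Fin n) ℂ} (h : IsOptimal X P Q)
    {P' Q' : Matrix (Fin n) (Fin n) ℂ} (hP' : P'.PosSemidef) (hQ' : Q'.PosSemidef)
    (hd : ∀ i, (P' i i).re + (Q' i i).re ≤ 1) :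
    (X * (P' - Q')).trace.re ≤ (X * (P - Q)).trace.re := by
  -- Half of the missing diagonal goes to each matrix, leaving the difference unchanged.
  set r : Fin n → ℝ := fun i => (1 - ((P' i i).re + (Q' i i).re)) / 2 with hr
  have hD : (Delta r).PosSemidef := by
    rw [Delta, Matrix.posSemidef_diagonal_iff]
    intro i
    have := hd i
    exact Complex.zero_le_real.2 (by simp only [hr]; linarith)
  have := h.le (P' + Delta r) (Q' + Delta r) (hP'.add hD) (hQ'.add hD) fun i => by
    simp only [Delta, Matrix.add_apply, Matrix.diagonal_apply_eq, Complex.add_re,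
      Complex.ofReal_re, hr]
    ring
  rwa [add_sub_add_right_eq_sub] at this

theorem isCompact_norm_apply_le_one :
    IsCompact {W : Matrix (Fin n) (Fin n) ℂ | ∀ k i, ‖W k i‖ ≤ 1} := by
  have hset : {W : Matrix (Fin n) (Fin n) ℂ | ∀ k i, ‖W k i‖ ≤ 1} =
      Set.pi Set.univ fun _ : Fin n => Set.pi Set.univ fun _ : Fin n =>
        Metric.closedBall (0 : ℂ) 1 :=
    Set.ext fun W => ⟨fun h k _ i _ => mem_closedBall_zero_iff.2 (h k i),
      fun h k i => mem_closedBall_zero_iff.1 (h k trivial i trivial)⟩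
  rw [hset]
  exact isCompact_univ_pi fun _ => isCompact_univ_pi fun _ => isCompact_closedBall _ _

theorem continuous_gram :
    Continuous fun W : Matrix (Fin n) (Fin n) ℂ => Wᴴ * W :=
  continuous_id.matrix_conjTranspose.matrix_mul continuous_id

/-- The pairs `(W, V)` for which `Wᴴ W + Vᴴ V` has unit diagonal. -/
def gramPairs (n : ℕ) : Set (Matrix (Fin n) (Fin n) ℂ × Matrix (Fin n) (Fin n) ℂ) :=
  {p | ∀ i, ((p.1ᴴ * p.1) i i).re + ((p.2ᴴ * p.2) i i).re = 1}

theorem isCompact_gramPairs : IsCompact (gramPairs n) := by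
  have hclosed : IsClosed (gramPairs n) := by
    have hInter : gramPairs n = ⋂ i, {p | ((p.1ᴴ * p.1) i i).re + ((p.2ᴴ * p.2) i i).re = 1} := by
      ext p; simp [gramPairs]
    rw [hInter]
    refine isClosed_iInter fun i => isClosed_eq ?_ continuous_const
    exact (Complex.continuous_re.comp ((continuous_gram.comp continuous_fst).matrix_elem i i)).add
      (Complex.continuous_re.comp ((continuous_gram.comp continuous_snd).matrix_elem i i))
  refine (isCompact_norm_apply_le_one.prod isCompact_norm_apply_le_one).of_isClosed_subset hclosed
    fun p hp => ?_
  have key (k i : Fin n) : ‖p.1 k i‖ ^ 2 ≤ 1 ∧ ‖p.2 k i‖ ^ 2 ≤ 1 := by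
    have h := hp i
    rw [re_gram_diag, re_gram_diag] at h
    have h1 : ‖p.1 k i‖ ^ 2 ≤ ∑ k, ‖p.1 k i‖ ^ 2 :=
      Finset.single_le_sum (f := fun k => ‖p.1 k i‖ ^ 2)
        (fun k _ => sq_nonneg _) (Finset.mem_univ k)
    have h2 : ‖p.2 k i‖ ^ 2 ≤ ∑ k, ‖p.2 k i‖ ^ 2 :=
      Finset.single_le_sum (f := fun k => ‖p.2 k i‖ ^ 2)
        (fun k _ => sq_nonneg _) (Finset.mem_univ k)
    have h3 := sq_nonneg ‖p.1 k i‖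
    have h4 := sq_nonneg ‖p.2 k i‖
    constructor <;> linarith
  exact ⟨fun k i => (sq_le_one_iff₀ (norm_nonneg _)).1 (key k i).1,
    fun k i => (sq_le_one_iff₀ (norm_nonneg _)).1 (key k i).2⟩

/-- Positive semidefinite matrices are Gram matrices, so it suffices to maximise over the compact
set of factor pairs. -/
theorem exists_isOptimal (X : Matrix (Fin n) (Fin n) ℂ) : ∃ P Q, IsOptimal X P Q := by
  have hne : (gramPairs n).Nonempty := ⟨(1, 0), fun i => by simp⟩
  have hcont : Continuous fun p : Matrix (Fin n) (Fin n) ℂ × Matrix (Fin n) (Fin n) ℂ =>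
      (X * (p.1ᴴ * p.1 - p.2ᴴ * p.2)).trace.re :=
    Complex.continuous_re.comp (continuous_const.matrix_mul
      ((continuous_gram.comp continuous_fst).sub
        (continuous_gram.comp continuous_snd))).matrix_trace
  obtain ⟨p, hp, hmax⟩ := isCompact_gramPairs.exists_isMaxOn hne hcont.continuousOn
  refine ⟨p.1ᴴ * p.1, p.2ᴴ * p.2, Matrix.posSemidef_conjTranspose_mul_self _,
    Matrix.posSemidef_conjTranspose_mul_self _, hp, fun P' Q' hP' hQ' hd => ?_⟩
  obtain ⟨W, rfl⟩ := CStarAlgebra.nonneg_iff_eq_star_mul_self.mp hP'.nonneg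
  obtain ⟨V, rfl⟩ := CStarAlgebra.nonneg_iff_eq_star_mul_self.mp hQ'.nonneg
  have hWV : (W, V) ∈ gramPairs n := hd
  exact isMaxOn_iff.1 hmax (W, V) hWV

/-! ### First variation at a maximiser -/

theorem linear_coeff_nonpos {a b c δ : ℝ} (hδ : 0 < δ)
    (h : ∀ t, 0 < t → t < δ → t * a + t ^ 2 * b + t ^ 3 * c ≤ 0) : a ≤ 0 := by
  have hcont : Continuous fun t : ℝ => a + t * b + t ^ 2 * c := by fun_prop
  have hlim : Filter.Tendsto (fun t : ℝ => a + t * b + t ^ 2 * c)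
      (nhdsWithin 0 (Set.Ioi 0)) (nhds a) := by
    have := (hcont.tendsto 0).mono_left (nhdsWithin_le_nhds (s := Set.Ioi 0))
    simpa using this
  refine le_of_tendsto hlim ?_
  filter_upwards [Ioo_mem_nhdsGT hδ] with t ht
  have h1 := h t ht.1 ht.2
  have h2 : t * (a + t * b + t ^ 2 * c) ≤ 0 := by linarith
  exact nonpos_of_mul_nonpos_right h2 ht.1

theorem mul_conj_expand {R : Type*} [Ring R] [Algebra ℂ R] (X Y S A : R) (t : ℂ) :
    X * ((1 - (t / 2) • A) * (Y + t • S) * (1 - (t / 2) • A)) = X * Y +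
      t • (X * S - (1 / 2 : ℂ) • (X * A * Y + X * Y * A)) +
      t ^ 2 • ((1 / 4 : ℂ) • (X * A * Y * A) - (1 / 2 : ℂ) • (X * A * S + X * S * A)) +
      t ^ 3 • ((1 / 4 : ℂ) • (X * A * S * A)) := by
  simp only [mul_add, mul_sub, sub_mul, add_mul, one_mul, mul_one, smul_mul_assoc,
    mul_smul_comm, mul_assoc]
  module

/-- Perturb `P` by `t v v*`, then conjugate both matrices by `D = 1 - (t/2) A`, with `A` the
diagonal of `v v*`, which restores the diagonal constraint to first order. The linear coefficient in
`t` of the objective is the difference of the two sides. -/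
theorem IsOptimal.form_le {X P Q : Matrix (Fin n) (Fin n) ℂ} (hX : X.IsHermitian)
    (h : IsOptimal X P Q) (v : Fin n → ℂ) :
    (star v ⬝ᵥ X *ᵥ v).re ≤ ∑ i, (((P - Q) * X) i i).re * ‖v i‖ ^ 2 := by
  set a : Fin n → ℝ := fun i => ‖v i‖ ^ 2 with ha
  have ha0 (i) : 0 ≤ a i := sq_nonneg _
  set S := Matrix.vecMulVec v (star v) with hS
  have hSpsd : S.PosSemidef := Matrix.posSemidef_vecMulVec_self_star v
  set Y := P - Q with hY
  have hYh : Y.IsHermitian := h.left.isHermitian.sub h.right.isHermitian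
  set A := Delta a with hA
  have hδ : 0 < (1 + ∑ i, a i)⁻¹ :=
    inv_pos.2 (add_pos_of_pos_of_nonneg one_pos (Finset.sum_nonneg fun i _ => ha0 i))
  have hfirst : (X * S - (1 / 2 : ℂ) • (X * A * Y + X * Y * A)).trace.re =
      (star v ⬝ᵥ X *ᵥ v).re - ∑ i, ((Y * X) i i).re * a i := by
    have e1 : (X * S).trace = star v ⬝ᵥ X *ᵥ v := by
      rw [hS, Matrix.mul_vecMulVec, Matrix.trace_vecMulVec, dotProduct_comm]
    have e2 : (X * A * Y).trace.re = ∑ i, ((Y * X) i i).re * a i := by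
      rw [Matrix.trace_mul_cycle, Matrix.trace, Complex.re_sum]
      refine Finset.sum_congr rfl fun i _ => ?_
      rw [Matrix.diag_apply, hA, Delta, Matrix.mul_diagonal, Complex.re_mul_ofReal]
    have e3 : (X * Y * A).trace.re = ∑ i, ((Y * X) i i).re * a i := by
      rw [Matrix.trace, Complex.re_sum]
      refine Finset.sum_congr rfl fun i _ => ?_
      have : X * Y = (Y * X)ᴴ := by rw [Matrix.conjTranspose_mul, hX.eq, hYh.eq]
      rw [Matrix.diag_apply, hA, Delta, Matrix.mul_diagonal, Complex.re_mul_ofReal, this]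
      rfl
    rw [Matrix.trace_sub, Matrix.trace_smul, Matrix.trace_add, Complex.sub_re, e1, smul_eq_mul,
      show (1 / 2 : ℂ) = ((1 / 2 : ℝ) : ℂ) by push_cast; rfl, Complex.re_ofReal_mul,
      Complex.add_re, e2, e3]
    ring
  rw [← sub_nonpos, ← hfirst]
  refine linear_coeff_nonpos (b := ((1 / 4 : ℂ) • (X * A * Y * A) -
      (1 / 2 : ℂ) • (X * A * S + X * S * A)).trace.re)
    (c := ((1 / 4 : ℂ) • (X * A * S * A)).trace.re) hδ fun t ht htδ => ?_
  set D := (1 : Matrix (Fin n) (Fin n) ℂ) - ((t : ℂ) / 2) • A with hD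
  have hDd : D = Matrix.diagonal fun i => ((1 - t / 2 * a i : ℝ) : ℂ) := by
    ext i j
    by_cases hij : i = j
    · subst hij; simp [hD, hA, Delta]
    · simp [hD, hA, Delta, hij]
  have hDh : Dᴴ = D := by rw [hDd]; exact isHermitian_Delta _
  have hP' : (D * (P + (t : ℂ) • S) * D).PosSemidef := by
    have := (h.left.add (hSpsd.smul (Complex.zero_le_real.2 ht.le))).conjTranspose_mul_mul_same D
    rwa [hDh] at this
  have hQ' : (D * Q * D).PosSemidef := by
    have := h.right.conjTranspose_mul_mul_same D
    rwa [hDh] at this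
  have hta (i) : t * a i ≤ 1 := by
    have h1 := Finset.single_le_sum (fun j _ => ha0 j) (Finset.mem_univ i)
    have h2 : t * (1 + ∑ i, a i) ≤ 1 := by
      have h3 := mul_le_mul_of_nonneg_right htδ.le (inv_pos.1 hδ).le
      rwa [inv_mul_cancel₀ (inv_pos.1 hδ).ne'] at h3
    nlinarith
  have hle := h.le_of_diag_le hP' hQ' fun i => by
    have hSi : (S i i).re = a i := by
      rw [hS, Matrix.vecMulVec_apply, Pi.star_apply, RCLike.star_def, Complex.mul_conj,
        Complex.ofReal_re, Complex.normSq_eq_norm_sq]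
    have e1 : ((D * (P + (t : ℂ) • S) * D) i i).re =
        (1 - t / 2 * a i) * ((P i i).re + t * a i) * (1 - t / 2 * a i) := by
      rw [hDd, Matrix.mul_diagonal, Matrix.diagonal_mul, Complex.re_mul_ofReal,
        Complex.re_ofReal_mul, Matrix.add_apply, Matrix.smul_apply, smul_eq_mul, Complex.add_re,
        Complex.re_ofReal_mul, hSi]
    have e2 : ((D * Q * D) i i).re = (1 - t / 2 * a i) * (Q i i).re * (1 - t / 2 * a i) := by
      rw [hDd, Matrix.mul_diagonal, Matrix.diagonal_mul, Complex.re_mul_ofReal,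
        Complex.re_ofReal_mul]
    have hQi : (Q i i).re = 1 - (P i i).re := by linarith [h.diag i]
    rw [e1, e2, hQi]
    -- With `x = t * a i`, the new diagonal is `(1 - x/2)² (1 + x) = 1 - x² (3 - x) / 4`.
    have h1 : 0 ≤ (t * a i) ^ 2 * (3 - t * a i) :=
      mul_nonneg (sq_nonneg _) (by linarith [hta i])
    linarith
  have hexp : D * (P + (t : ℂ) • S) * D - D * Q * D = D * (Y + (t : ℂ) • S) * D := by
    rw [hY, ← Matrix.sub_mul, ← Matrix.mul_sub]
    congr 2
    abel
  rw [hexp, hD, mul_conj_expand, Matrix.trace_add, Matrix.trace_add, Matrix.trace_add,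
    Matrix.trace_smul _ (_ - _), Matrix.trace_smul _ (_ - _), Matrix.trace_smul ((t : ℂ) ^ 3),
    smul_eq_mul, smul_eq_mul, smul_eq_mul, ← Complex.ofReal_pow, ← Complex.ofReal_pow,
    Complex.add_re, Complex.add_re, Complex.add_re, Complex.re_ofReal_mul, Complex.re_ofReal_mul,
    Complex.re_ofReal_mul] at hle
  linarith

/-! ### Complementary slackness and equality of the two values -/

theorem trace_mul_nonneg_and_eq_zero {P S : Matrix (Fin n) (Fin n) ℂ} (hP : P.PosSemidef)
    (hS : S.PosSemidef) : 0 ≤ (P * S).trace.re ∧ ((P * S).trace.re = 0 → P * S = 0) := by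
  obtain ⟨W, rfl⟩ := CStarAlgebra.nonneg_iff_eq_star_mul_self.mp hP.nonneg
  obtain ⟨V, rfl⟩ := CStarAlgebra.nonneg_iff_eq_star_mul_self.mp hS.nonneg
  simp only [Matrix.star_eq_conjTranspose]
  have htr : (Wᴴ * W * (Vᴴ * V)).trace = ((W * Vᴴ)ᴴ * (W * Vᴴ)).trace := by
    rw [← Matrix.mul_assoc, Matrix.trace_mul_comm, Matrix.conjTranspose_mul,
      Matrix.conjTranspose_conjTranspose]
    simp only [Matrix.mul_assoc]
  have hnn := (Matrix.posSemidef_conjTranspose_mul_self (W * Vᴴ)).trace_nonneg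
  rw [htr]
  refine ⟨(Complex.le_def.1 hnn).1, fun h0 => ?_⟩
  have hz : ((W * Vᴴ)ᴴ * (W * Vᴴ)).trace = 0 :=
    Complex.ext h0 (Complex.le_def.1 hnn).2.symm
  rw [Matrix.trace_conjTranspose_mul_self_eq_zero_iff] at hz
  rw [Matrix.mul_assoc, ← Matrix.mul_assoc W, hz, Matrix.zero_mul, Matrix.mul_zero]

/-- Equal values make the nonnegative traces of `P (Δ - X)` and `Q (X + Δ)` sum to zero, so both
products vanish; adding their diagonals isolates `lam i`, as `P + Q` has unit diagonal. -/
theorem IsOptimal.eq_of_sum_eq {X P Q : Matrix (Fin n) (Fin n) ℂ} (h : IsOptimal X P Q)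
    {lam : Fin n → ℝ} (h1 : -Delta lam ≤ X) (h2 : X ≤ Delta lam)
    (hsum : ∑ i, lam i = ((P - Q) * X).trace.re) (i : Fin n) :
    lam i = (((P - Q) * X) i i).re := by
  have hp := trace_mul_nonneg_and_eq_zero h.left (Matrix.le_iff.1 h2)
  have hq := trace_mul_nonneg_and_eq_zero h.right (Matrix.le_iff.1 h1)
  have hdiag (i : Fin n) : ((P * (Delta lam - X)) i i).re + ((Q * (X - -Delta lam)) i i).re =
      lam i - (((P - Q) * X) i i).re := by
    simp only [Matrix.mul_sub, Matrix.sub_mul, Matrix.mul_neg, Matrix.sub_apply, Matrix.neg_apply,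
      Complex.sub_re, Complex.neg_re, Delta, Matrix.mul_diagonal, Complex.re_mul_ofReal]
    have := h.diag i
    linear_combination lam i * this
  have htr : (P * (Delta lam - X)).trace.re + (Q * (X - -Delta lam)).trace.re = 0 := by
    rw [← sub_eq_zero.2 hsum]
    simp only [Matrix.trace, Complex.re_sum, Matrix.diag_apply]
    rw [← Finset.sum_add_distrib, ← Finset.sum_sub_distrib]
    exact Finset.sum_congr rfl fun i _ => hdiag i
  have hi := hdiag i
  rw [hp.2 (by linarith [hp.1, hq.1]), hq.2 (by linarith [hp.1, hq.1])] at hi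
  simp only [Matrix.zero_apply, Complex.zero_re, add_zero] at hi
  linarith

/-- The lower bound is the upper one for `-X`, for which `(Q, P)` is optimal. -/
theorem IsOptimal.bounds {X P Q : Matrix (Fin n) (Fin n) ℂ} (hX : X.IsHermitian)
    (h : IsOptimal X P Q) :
    -Delta (fun i => (((P - Q) * X) i i).re) ≤ X ∧ X ≤ Delta fun i => (((P - Q) * X) i i).re := by
  refine ⟨(neg_Delta_le_iff hX _).2 fun v => ?_, (le_Delta_iff hX _).2 (h.form_le hX)⟩
  have := h.neg_swap.form_le hX.neg v
  rwa [Matrix.neg_mulVec, dotProduct_neg, Complex.neg_re, Matrix.mul_neg, ← Matrix.neg_mul,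
    neg_sub] at this

theorem nonneg_of_bounds {X : Matrix (Fin n) (Fin n) ℂ} {lam : Fin n → ℝ}
    (h1 : -Delta lam ≤ X) (h2 : X ≤ Delta lam) (i : Fin n) : 0 ≤ lam i := by
  have h := ((Matrix.le_iff.1 h2).add (Matrix.le_iff.1 h1)).diag_nonneg (i := i)
  have := (Complex.le_def.1 h).1
  simp [Delta] at this
  linarith

theorem IsOptimal.cbBNorm_eq {X P Q : Matrix (Fin n) (Fin n) ℂ} (hX : X.IsHermitian)
    (h : IsOptimal X P Q) : cbBNorm X = ((P - Q) * X).trace.re := by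
  obtain ⟨h1, h2⟩ := h.bounds hX
  have hnn := nonneg_of_bounds h1 h2
  have hsum : ∑ i, (((P - Q) * X) i i).re = ((P - Q) * X).trace.re := by
    rw [Matrix.trace, Complex.re_sum]; rfl
  refine le_antisymm ((cbBNorm_le hX hnn h1 h2).trans_eq hsum) ?_
  have := le_cbBNorm hX hnn h1 h2 (schurNorm_sub_le_one h.left h.right h.diag)
  rw [(h.left.isHermitian.sub h.right.isHermitian).eq] at this
  exact (Complex.re_le_norm _).trans this

end SchurDual

theorem theorem1p8 {n : ℕ} (X : Matrix (Fin n) (Fin n) ℂ) (hX : X.IsHermitian) :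
    (∀ lam : Fin n → ℝ, (∀ i, 0 ≤ lam i) →
      -SchurDual.Delta lam ≤ X → X ≤ SchurDual.Delta lam →
        SchurDual.cbBNorm X ≤ (SchurDual.Delta lam).trace.re) ∧
    (∃! lam : Fin n → ℝ, (∀ i, 0 ≤ lam i) ∧
      (SchurDual.Delta lam).trace = (SchurDual.cbBNorm X : ℂ) ∧
      ∃ B : Matrix (Fin n) (Fin n) ℂ, SchurDual.IsFactor X lam B) ∧
    (∀ lam : Fin n → ℝ, (∀ i, 0 ≤ lam i) →
      (SchurDual.Delta lam).trace = (SchurDual.cbBNorm X : ℂ) →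
      (∃ B : Matrix (Fin n) (Fin n) ℂ, SchurDual.IsFactor X lam B) →
      ∃! B : Matrix (Fin n) (Fin n) ℂ, SchurDual.IsFactor X lam B ∧
        SchurDual.support B ≤ SchurDual.support (SchurDual.Delta lam)) := by
  refine ⟨fun lam hlam h1 h2 => ?_, ?_, fun lam hlam _ ⟨B, hB⟩ => ?_⟩
  · rw [SchurDual.trace_Delta, Complex.ofReal_re]
    exact SchurDual.cbBNorm_le hX hlam h1 h2
  · obtain ⟨P, Q, h⟩ := SchurDual.exists_isOptimal X
    obtain ⟨h1, h2⟩ := h.bounds hX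
    have hnn := SchurDual.nonneg_of_bounds h1 h2
    refine ⟨fun i => (((P - Q) * X) i i).re,
      ⟨hnn, ?_, _, SchurDual.isFactor_compression hX hnn h1 h2⟩, ?_⟩
    · rw [SchurDual.trace_Delta, h.cbBNorm_eq hX, Matrix.trace, Complex.re_sum]
      rfl
    · rintro mu ⟨hmu, htr, B, hB⟩
      obtain ⟨b1, b2⟩ := SchurDual.isFactor_bounds hmu hB
      rw [SchurDual.trace_Delta, h.cbBNorm_eq hX] at htr
      exact funext (h.eq_of_sum_eq b1 b2 (Complex.ofReal_injective htr))
  · obtain ⟨b1, b2⟩ := SchurDual.isFactor_bounds hlam hB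
    exact SchurDual.existsUnique_isFactor_support_le hX hlam b1 b2
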